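/- Let $\mathcal{C}$ be the class of all commutative monoids that can be embedded into a free commutative monoid of finite rank, that is, into $(\mathbb{N}^d,+)$ for some $d \in \mathbb{N}$; such monoids are cancellative and reduced. For $M$ in $\mathcal{C}$, put $M^\bullet = M \setminus \{0\}$, let $\mathrm{gp}(M)$ be the Grothendieck group of $M$, set $V = \mathbb{R} \otimes_{\mathbb{Z}} \mathrm{gp}(M)$, and let $\mathsf{cone}_V(M) \subseteq V$ be the set of all finite linear combinations, with nonnegative real coefficients, of images of elements of $M$ under $M \to \mathrm{gp}(M) \to V$. A cone in $V$ is polyhedral if it is the intersection of finitely many closed half-spaces $\{x \in V \mid f(x) \ge 0\}$ with $f$ a linear functional on $V$. A monoid $M$ in $\mathcal{C}$ is finitary if (i) $M$ is a bounded factorization monoid, that is, every $x \in M$ is a finite (possibly empty) sum of atoms (an atom is an element of $M^\bullet$ that is not a sum of two elements of $M^\bullet$), and for each $x \in M$ the set of all $\ell$ such that $x$ is a sum of $\ell$ atoms is finite; and (ii) there exist a finite set $S \subseteq M^\bullet$ and an integer $n \ge 1$ such that $n M^\bullet \subseteq S + M$, that is, for all $x_1, \dots, x_n \in M^\bullet$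 there are $s \in S$ and $m \in M$ with $x_1 + \cdots + x_n = s + m$. **Theorem.** Let $M$ be a monoid in $\mathcal{C}$, and set $V = \mathbb{R} \otimes_{\mathbb{Z}} \mathrm{gp}(M)$. If $\mathsf{cone}_V(M)$ is polyhedral, then $M$ is finitary. -/

import Mathlib

open scoped TensorProduct

noncomputable section

namespace ConicMonoid

universe u

/-- Membership in the class `𝒞`: the commutative monoid `M` embeds into a free commutative monoid
of finite rank, that is, into `ℕᵈ` for some natural number `d`. Such an `M` is automatically
cancellative, reduced and torsion-free. -/
def MemClassC (M : Type u) [AddCommMonoid M] : Prop :=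
  ∃ (d : ℕ) (φ : M →+ (Fin d → ℕ)), Function.Injective φ

/-- The real vector space `V = ℝ ⊗_ℤ gp(M)`, with `gp(M)` the Grothendieck group of `M`. -/
abbrev Ambient (M : Type u) [AddCommMonoid M] : Type u :=
  ℝ ⊗[ℤ] Algebra.GrothendieckAddGroup M

/-- The canonical map `M → gp(M) → ℝ ⊗_ℤ gp(M)`, `x ↦ 1 ⊗ x`. -/
def toAmbient (M : Type u) [AddCommMonoid M] (x : M) : Ambient M :=
  (1 : ℝ) ⊗ₜ[ℤ] Algebra.GrothendieckAddGroup.of x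

/-- The conic hull of (the image of) `M` in `V = ℝ ⊗_ℤ gp(M)`. -/
def cone (M : Type u) [AddCommMonoid M] : PointedCone ℝ (Ambient M) :=
  PointedCone.hull ℝ (Set.range (toAmbient M))

/-- A cone in a real vector space is polyhedral if it is the intersection of finitely many closed
half-spaces `{x | 0 ≤ f x}`, with `f` a linear functional. (Allowing `f = 0`, which imposes no
condition, does not change the notion.) -/
def IsPolyhedral {V : Type u} [AddCommGroup V] [Module ℝ V] (C : PointedCone ℝ V) : Prop :=
  C.DualFG (LinearMap.id : Module.Dual ℝ V →ₗ[ℝ] Module.Dual ℝ V)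

/-- The set of factorizations of `x`: finite formal sums (multisets) of atoms adding up to `x`. -/
def factorizations {M : Type u} [AddCommMonoid M] (x : M) : Set (Multiset M) :=
  {z | (∀ a ∈ z, AddIrreducible a) ∧ z.sum = x}

/-- The set of lengths of `x`. -/
def lengths {M : Type u} [AddCommMonoid M] (x : M) : Set ℕ :=
  Multiset.card '' factorizations x

/-- A reduced monoid is a BFM (bounded factorization monoid) if it is atomic and every element
has only finitely many factorization lengths. -/
def IsBFM (M : Type u) [AddCommMonoid M] : Prop :=
  ∀ x : M, (factorizations x).Nonempty ∧ (lengths x).Finite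

/-- A reduced monoid `M` is finitary if it is a BFM and there are a finite set `S` of *nonzero*
elements of `M` and a positive integer `n` such that every sum of `n` nonzero elements of `M` lies
in `S + M`. -/
def IsFinitary (M : Type u) [AddCommMonoid M] : Prop :=
  IsBFM M ∧ ∃ (S : Finset M) (n : ℕ), (∀ s ∈ S, s ≠ 0) ∧ 0 < n ∧
    ∀ x : Fin n → M, (∀ i, x i ≠ 0) → ∃ s ∈ S, ∃ m : M, ∑ i, x i = s + m

end ConicMonoid

end

/-!
The set of atoms of `M` is finite, and it serves as `S` with `n = 1`, since a nonzero element of an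
atomic monoid is an atom plus something.

By the Minkowski–Weyl theorem (`fg_of_dualFG`) a polyhedral cone is finitely generated, so
`cone M` is generated by the images of a finite set `T ⊆ M`. With `M` embedded in `ℕᵈ` by `φ`, every
`x` satisfies `φ x = ∑ t ∈ T, aₜ φ t` with real `aₜ ≥ 0`. Taking integer parts,
`φ x = r + ∑ t ∈ T, ⌊aₜ⌋ φ t` with `r ∈ ℕᵈ` bounded by `∑ t ∈ T, φ t`, so only finitely many
remainders `r` occur. If `x` and `y` have the same remainder and the integer parts of `x` are at most
those of `y`, then `y - x` is a sum of elements of `T`. By Dickson's lemma the divisibility relation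
`∃ m, y = x + m` is therefore a well-quasi-order on `M` (`wellQuasiOrdered_exists_eq_add`). Atoms are
pairwise incomparable for it, so there are finitely many of them.

The bounded factorization property holds for every monoid that embeds in `ℕᵈ`, because the
coordinate sum is additive and positive off zero.
-/

namespace ConicMonoid

/-! ### The Minkowski–Weyl theorem -/

section MinkowskiWeyl

variable {V : Type*} [AddCommGroup V] [Module ℝ V]

/-- The Fourier–Motzkin step: a finitely generated cone cut by a closed half-space is finitely
generated, by the generators on which `f` is nonnegative and the combinations in `ker f` of a
generator with `0 ≤ f` and one with `f < 0`. -/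
lemma fg_inf_dual_singleton {C : PointedCone ℝ V} (hC : C.FG) (f : Module.Dual ℝ V) :
    (PointedCone.dual (LinearMap.id : Module.Dual ℝ V →ₗ[ℝ] Module.Dual ℝ V) {f} ⊓ C).FG := by
  classical
  obtain ⟨s, rfl⟩ := hC
  set P : Set V := {v | v ∈ s ∧ 0 ≤ f v} with hP
  set N : Set V := {v | v ∈ s ∧ f v < 0} with hN
  have hPfin : P.Finite := s.finite_toSet.subset fun v hv => hv.1
  have hNfin : N.Finite := s.finite_toSet.subset fun v hv => hv.1
  set G : Set V := P ∪ Set.image2 (fun p q => f p • q - f q • p) P N with hG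
  have hGfin : G.Finite := hPfin.union (hPfin.image2 _ hNfin)
  suffices h : PointedCone.dual (LinearMap.id : Module.Dual ℝ V →ₗ[ℝ] Module.Dual ℝ V) {f} ⊓
      PointedCone.hull ℝ (s : Set V) = PointedCone.hull ℝ G by
    change (_ ⊓ PointedCone.hull ℝ (s : Set V)).FG
    rw [h]
    exact Submodule.fg_span hGfin
  apply le_antisymm
  · rintro x ⟨hfx, hx⟩
    replace hfx : 0 ≤ f x := hfx (Set.mem_singleton f)
    have hs : (s : Set V) = P ∪ N := by
      ext v
      simp only [hP, hN, Set.mem_union, Set.mem_ofPred_eq, Finset.mem_coe, ← and_or_left,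
        le_or_gt, and_true]
    change x ∈ Submodule.span _ (s : Set V) at hx
    rw [hs, Submodule.span_union, Submodule.mem_sup] at hx
    obtain ⟨p, hp, q, hq, rfl⟩ := hx
    have hpG : p ∈ PointedCone.hull ℝ G := Submodule.span_mono Set.subset_union_left hp
    -- `f p • q - f q • p` is linear in each variable, so it suffices to check generators.
    have hcross : f p • q - f q • p ∈ PointedCone.hull ℝ G := by
      have hN : ∀ p ∈ P, f p • q - f q • p ∈ PointedCone.hull ℝ G := fun p hp => by
        have hle : PointedCone.hull ℝ N ≤ (PointedCone.hull ℝ G).comap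
            (f p • LinearMap.id - f.smulRight p) := by
          refine Submodule.span_le.2 fun q hq => ?_
          exact Submodule.subset_span (Or.inr ⟨p, hp, q, hq, rfl⟩)
        exact hle hq
      have hle : PointedCone.hull ℝ P ≤ (PointedCone.hull ℝ G).comap
          (f.smulRight q - f q • LinearMap.id) :=
        Submodule.span_le.2 hN
      exact hle hp
    have hfq : q = 0 ∨ f q < 0 := by
      clear hfx hcross
      induction hq using Submodule.span_induction with
      | mem q hq => exact Or.inr hq.2
      | zero => exact Or.inl rfl
      | add q q' _ _ h h' =>
        rcases h with rfl | h <;> rcases h' with rfl | h'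
        · simp
        · simpa using Or.inr h'
        · simpa using Or.inr h
        · right; rw [map_add]; linarith
      | smul a q _ h =>
        rcases h with rfl | h
        · simp
        · change (a : ℝ) • q = 0 ∨ f ((a : ℝ) • q) < 0
          rcases a.2.eq_or_lt with ha | ha
          · left; rw [← ha, zero_smul]
          · right; rw [map_smul, smul_eq_mul]; exact mul_neg_of_pos_of_neg ha h
    rw [map_add] at hfx
    rcases hfq with rfl | hfq
    · simpa using hpG
    · have hfp : 0 < f p := by linarith
      -- `f p • (p + q) = (f p • q - f q • p) + f (p + q) • p`
      have h := (PointedCone.hull ℝ G).smul_mem (inv_nonneg.2 hfp.le)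
        (add_mem hcross ((PointedCone.hull ℝ G).smul_mem hfx hpG))
      convert h using 1
      rw [← sub_eq_zero]
      match_scalars <;> field_simp <;> ring
  · refine Submodule.span_le.2 ?_
    rintro x (hx | ⟨p, hp, q, hq, rfl⟩)
    · exact ⟨by rintro _ rfl; exact hx.2, Submodule.subset_span hx.1⟩
    · refine ⟨?_, ?_⟩
      · rintro _ rfl
        simp [mul_comm]
      · have h1 := (PointedCone.hull ℝ (s : Set V)).smul_mem hp.2 (Submodule.subset_span hq.1)
        have h2 := (PointedCone.hull ℝ (s : Set V)).smul_mem (neg_nonneg.2 hq.2.le)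
          (Submodule.subset_span hp.1)
        simpa [sub_eq_add_neg] using add_mem h1 h2

/-- One direction of the Minkowski–Weyl theorem: in finite dimension a polyhedral cone is finitely
generated, by adding one half-space at a time. -/
lemma fg_of_dualFG [Module.Finite ℝ V] {C : PointedCone ℝ V}
    (hC : C.DualFG (LinearMap.id : Module.Dual ℝ V →ₗ[ℝ] Module.Dual ℝ V)) : C.FG := by
  classical
  obtain ⟨s, rfl⟩ := hC
  induction s using Finset.induction_on with
  | empty =>
    rw [Finset.coe_empty, PointedCone.dual_empty]
    exact Module.Finite.fg_top
  | insert f s _ ih =>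
    rw [Finset.coe_insert, PointedCone.dual_insert]
    exact fg_inf_dual_singleton ih f

end MinkowskiWeyl

/-! ### Monoids embedded in `ℕᵈ` and their ambient space -/

section Embedding

variable {M : Type*} [AddCommMonoid M] {d : ℕ}

/-- The extension to Grothendieck groups of a homomorphism `M → ℕᵈ`, with values in `ℤᵈ`. -/
noncomputable def grothendieckToInt (φ : M →+ (Fin d → ℕ)) :
    Algebra.GrothendieckAddGroup M →+ (Fin d → ℤ) :=
  Algebra.GrothendieckAddGroup.lift
    (((Nat.castAddMonoidHom ℤ).compLeft (Fin d)).comp φ)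

lemma grothendieckToInt_of (φ : M →+ (Fin d → ℕ)) (x : M) (j : Fin d) :
    grothendieckToInt φ (Algebra.GrothendieckAddGroup.of x) j = (φ x j : ℤ) := by
  have h := Algebra.GrothendieckAddGroup.lift.symm_apply_apply
    (((Nat.castAddMonoidHom ℤ).compLeft (Fin d)).comp φ)
  exact congrFun (DFunLike.congr_fun h x) j

lemma grothendieckToInt_injective {φ : M →+ (Fin d → ℕ)} (hφ : Function.Injective φ) :
    Function.Injective (grothendieckToInt φ) := by
  rw [injective_iff_map_eq_zero]
  intro z hz
  obtain ⟨⟨x, y⟩, hxy⟩ := (AddLocalization.addMonoidOf (⊤ : AddSubmonoid M)).surj z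
  change z + Algebra.GrothendieckAddGroup.of (y : M) = Algebra.GrothendieckAddGroup.of x at hxy
  have h := congrArg (grothendieckToInt φ) hxy
  rw [map_add, hz, zero_add] at h
  have hyx : (y : M) = x := hφ <| funext fun j => by
    have := congrFun h j
    rw [grothendieckToInt_of, grothendieckToInt_of] at this
    exact_mod_cast this
  rw [hyx] at hxy
  exact add_eq_right.1 hxy

lemma finite_ambient (hM : MemClassC M) : Module.Finite ℝ (Ambient M) := by
  obtain ⟨d, φ, hφ⟩ := hM
  have : Module.Finite ℤ (Algebra.GrothendieckAddGroup M) :=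
    Module.Finite.of_injective (grothendieckToInt φ).toIntLinearMap
      (grothendieckToInt_injective hφ)
  infer_instance

/-- The extension to the ambient space of a homomorphism `M → ℕᵈ`, with values in `ℝᵈ`. -/
noncomputable def ambientToReal (φ : M →+ (Fin d → ℕ)) : Ambient M →ₗ[ℝ] (Fin d → ℝ) :=
  TensorProduct.AlgebraTensorModule.lift
    (LinearMap.toSpanSingleton ℝ _
      (((Int.castAddHom ℝ).compLeft (Fin d)).comp (grothendieckToInt φ)).toIntLinearMap)

lemma ambientToReal_toAmbient (φ : M →+ (Fin d → ℕ)) (x : M) (j : Fin d) :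
    ambientToReal φ (toAmbient M x) j = (φ x j : ℝ) := by
  have h : ambientToReal φ (toAmbient M x) j =
      (1 : ℝ) * (grothendieckToInt φ (Algebra.GrothendieckAddGroup.of x) j : ℝ) := rfl
  rw [h, grothendieckToInt_of, one_mul, Int.cast_natCast]

/-- Finitely many elements of `M` generate `cone M`, because a finitely generated span is spanned by
a finite part of the given generating set. The relation is stated in the coordinates of `φ`. -/
lemma exists_finset_conic_combination (hM : MemClassC M) (hcone : IsPolyhedral (cone M))
    (φ : M →+ (Fin d → ℕ)) :
    ∃ T : Finset M, ∀ x : M, ∃ a : M → ℝ, (∀ t, 0 ≤ a t) ∧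
      ∀ j, (φ x j : ℝ) = ∑ t ∈ T, a t * φ t j := by
  classical
  have := finite_ambient hM
  obtain ⟨s, hs, hspan⟩ := (Submodule.fg_span_iff_fg_span_finset_subset _).1 (fg_of_dualFG hcone)
  obtain ⟨T, rfl⟩ : ∃ T : Finset M, T.image (toAmbient M) = s := by
    rw [← Set.image_univ] at hs
    obtain ⟨T, -, hT⟩ := Finset.subset_set_image_iff.1 hs
    exact ⟨T, hT⟩
  refine ⟨T, fun x => ?_⟩
  have hx : toAmbient M x ∈ Submodule.span {c : ℝ // 0 ≤ c} (toAmbient M '' (T : Set M)) := by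
    rw [← Finset.coe_image, ← hspan]
    exact Submodule.subset_span ⟨x, rfl⟩
  obtain ⟨c, hc⟩ := (Submodule.mem_span_image_finset_iff_exists_fun' _).1 hx
  change ∑ t ∈ T, (c t : ℝ) • toAmbient M t = toAmbient M x at hc
  refine ⟨fun t => c t, fun t => (c t).2, fun j => ?_⟩
  rw [← ambientToReal_toAmbient φ x j, ← hc, map_sum, Finset.sum_apply]
  refine Finset.sum_congr rfl fun t _ => ?_
  rw [map_smul, Pi.smul_apply, ambientToReal_toAmbient, smul_eq_mul]

/-! ### Divisibility is a well-quasi-order -/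

/-- Divisibility is a well-quasi-order: pull back the product of equality of remainders and the
componentwise order of integer parts. -/
lemma wellQuasiOrdered_exists_eq_add (hM : MemClassC M) (hcone : IsPolyhedral (cone M)) :
    WellQuasiOrdered fun x y : M => ∃ m, y = x + m := by
  classical
  obtain ⟨d, φ, hφ⟩ := id hM
  obtain ⟨T, hT⟩ := exists_finset_conic_combination hM hcone φ
  choose a ha0 ha using hT
  have hfloor : ∀ x j, ∑ t ∈ T, ⌊a x t⌋₊ * φ t j ≤ φ x j := fun x j => by
    have : ((∑ t ∈ T, ⌊a x t⌋₊ * φ t j : ℕ) : ℝ) ≤ φ x j := by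
      rw [ha]
      push_cast
      gcongr with t
      exact Nat.floor_le (ha0 x t)
    exact_mod_cast this
  -- The remainder after taking integer parts; by `hfloor` the subtraction does not truncate.
  let r : M → Fin d → ℕ := fun x j => φ x j - ∑ t ∈ T, ⌊a x t⌋₊ * φ t j
  have hr : ∀ x, r x ∈ Set.Iic (∑ t ∈ T, φ t) := fun x j => by
    have : (φ x j : ℝ) ≤ ((∑ t ∈ T, φ t j + ∑ t ∈ T, ⌊a x t⌋₊ * φ t j : ℕ) : ℝ) := by
      rw [ha, ← Finset.sum_add_distrib]
      push_cast
      refine Finset.sum_le_sum fun t _ => ?_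
      have := (Nat.lt_floor_add_one (a x t)).le
      have h0 : (0 : ℝ) ≤ φ t j := Nat.cast_nonneg _
      nlinarith
    have : φ x j ≤ ∑ t ∈ T, φ t j + ∑ t ∈ T, ⌊a x t⌋₊ * φ t j := by exact_mod_cast this
    simpa [r] using this
  let g : M → Set.Iic (∑ t ∈ T, φ t) × (T → ℕ) := fun x => (⟨r x, hr x⟩, fun t => ⌊a x t⌋₊)
  have hwqo := (Finite.wellQuasiOrdered (α := Set.Iic (∑ t ∈ T, φ t)) (· = ·)).prod
    (wellQuasiOrdered_le (α := T → ℕ))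
  intro f
  obtain ⟨m, n, hmn, hrem, hle⟩ := hwqo (g ∘ f)
  refine ⟨m, n, hmn, ∑ t ∈ T, (⌊a (f n) t⌋₊ - ⌊a (f m) t⌋₊) • t, hφ <| funext fun j => ?_⟩
  have hsum : ∑ t ∈ T, ⌊a (f n) t⌋₊ * φ t j = ∑ t ∈ T, ⌊a (f m) t⌋₊ * φ t j +
      ∑ t ∈ T, (⌊a (f n) t⌋₊ - ⌊a (f m) t⌋₊) * φ t j := by
    rw [← Finset.sum_add_distrib]
    refine Finset.sum_congr rfl fun t ht => ?_
    have hle' : ⌊a (f m) t⌋₊ ≤ ⌊a (f n) t⌋₊ := hle ⟨t, ht⟩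
    rw [← add_mul, Nat.add_sub_cancel' hle']
  have hrem' : r (f m) j = r (f n) j := congrFun (congrArg Subtype.val hrem) j
  have h1 := hfloor (f m) j
  have h2 := hfloor (f n) j
  simp only [r] at hrem'
  simp only [map_add, map_sum, map_nsmul, Pi.add_apply, Finset.sum_apply, Pi.smul_apply,
    smul_eq_mul]
  omega

/-! ### Atoms and factorizations -/

lemma isAddUnit_iff_eq_zero {φ : M →+ (Fin d → ℕ)} (hφ : Function.Injective φ) {x : M} :
    IsAddUnit x ↔ x = 0 := by
  refine ⟨fun h => hφ ?_, fun h => h ▸ isAddUnit_zero⟩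
  rw [map_zero]
  exact (h.map φ).eq_zero

/-- The degree of an element of `M` in `ℕᵈ`: its coordinate sum. -/
def degree (φ : M →+ (Fin d → ℕ)) : M →+ ℕ where
  toFun x := ∑ j, φ x j
  map_zero' := by simp
  map_add' x y := by simp [Finset.sum_add_distrib]

lemma degree_eq_zero_iff {φ : M →+ (Fin d → ℕ)} (hφ : Function.Injective φ) {x : M} :
    degree φ x = 0 ↔ x = 0 := by
  refine ⟨fun h => hφ <| funext fun j => ?_, fun h => h ▸ map_zero _⟩
  change ∑ j, φ x j = 0 at h
  simpa using Finset.sum_eq_zero_iff.1 h j (Finset.mem_univ j)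

lemma exists_factorization {φ : M →+ (Fin d → ℕ)} (hφ : Function.Injective φ) (x : M) :
    (factorizations x).Nonempty := by
  induction h : degree φ x using Nat.strong_induction_on generalizing x with
  | _ k ih =>
    subst h
    by_cases hx : x = 0
    · exact ⟨0, by simp, by simp [hx]⟩
    by_cases hatom : AddIrreducible x
    · exact ⟨{x}, by simpa using hatom, by simp⟩
    have hex : ∃ y z, x = y + z ∧ y ≠ 0 ∧ z ≠ 0 := by
      by_contra! hcon
      refine hatom ⟨fun h => hx ((isAddUnit_iff_eq_zero hφ).1 h), fun y z hyz => ?_⟩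
      rw [isAddUnit_iff_eq_zero hφ, isAddUnit_iff_eq_zero hφ]
      exact or_iff_not_imp_left.2 (hcon y z hyz)
    obtain ⟨y, z, rfl, hy, hz⟩ := hex
    have hy' := mt (degree_eq_zero_iff hφ).1 hy
    have hz' := mt (degree_eq_zero_iff hφ).1 hz
    obtain ⟨u, hu, hus⟩ := ih (degree φ y) (by rw [map_add]; omega) y rfl
    obtain ⟨v, hv, hvs⟩ := ih (degree φ z) (by rw [map_add]; omega) z rfl
    refine ⟨u + v, fun a ha => ?_, by rw [Multiset.sum_add, hus, hvs]⟩
    exact (Multiset.mem_add.1 ha).elim (hu a) (hv a)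

/-- Every atom has degree at least `1`, so the degree of `x` bounds the lengths of `x`. -/
lemma isBFM_of_memClassC (hM : MemClassC M) : IsBFM M := by
  obtain ⟨d, φ, hφ⟩ := hM
  refine fun x => ⟨exists_factorization hφ x, (Set.finite_Iic (degree φ x)).subset ?_⟩
  rintro _ ⟨z, ⟨hz, rfl⟩, rfl⟩
  rw [Set.mem_Iic, map_multiset_sum]
  have h := Multiset.card_nsmul_le_sum (s := z.map (degree φ)) (a := 1) fun n hn => by
    obtain ⟨a, ha, rfl⟩ := Multiset.mem_map.1 hn
    exact Nat.one_le_iff_ne_zero.2 (mt (degree_eq_zero_iff hφ).1 (hz a ha).ne_zero)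
  simpa using h

lemma finite_setOf_addIrreducible (hM : MemClassC M) (hcone : IsPolyhedral (cone M)) :
    {a : M | AddIrreducible a}.Finite := by
  obtain ⟨d, φ, hφ⟩ := id hM
  refine IsAntichain.finite_of_wellQuasiOrdered ?_ (wellQuasiOrdered_exists_eq_add hM hcone)
  rintro a ha _ hb hne ⟨m, rfl⟩
  rcases hb.isAddUnit_or_isAddUnit rfl with h | h
  · exact ha.not_isAddUnit h
  · exact hne (by rw [(isAddUnit_iff_eq_zero hφ).1 h, add_zero])

end Embedding

end ConicMonoid

theorem mainTheorem7 {M : Type*} [AddCommMonoid M] (hM : ConicMonoid.MemClassC M)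
    (hcone : ConicMonoid.IsPolyhedral (ConicMonoid.cone M)) :
    ConicMonoid.IsFinitary M := by
  have hfin := ConicMonoid.finite_setOf_addIrreducible hM hcone
  have hBFM := ConicMonoid.isBFM_of_memClassC hM
  refine ⟨hBFM, hfin.toFinset, 1, fun s hs => (hfin.mem_toFinset.1 hs).ne_zero, one_pos,
    fun x hx => ?_⟩
  obtain ⟨z, hz, hsum⟩ := (hBFM (x 0)).1
  have hz0 : z ≠ 0 := by
    rintro rfl
    exact hx 0 hsum.symm
  obtain ⟨a, ha⟩ := Multiset.exists_mem_of_ne_zero hz0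
  obtain ⟨w, rfl⟩ := Multiset.exists_cons_of_mem ha
  refine ⟨a, hfin.mem_toFinset.2 (hz a ha), w.sum, ?_⟩
  rw [Fin.sum_univ_one, ← hsum, Multiset.sum_cons]
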